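/- Let $b>1$ and let $\lambda_e,P_\ell,r_\ell,\sigma_\ell,\sigma_e>0$. A transmitter of power $P_\ell$ sits at the origin of $\mathbb{R}^2$ and its legitimate receiver is at distance $r_\ell$; links of length $r$ have power gain $g(r)=r^{-2b}$; the noise powers at the legitimate receiver and at the eavesdroppers are $\sigma_\ell^2$ and $\sigma_e^2$. The eavesdroppers form a homogeneous Poisson point process $\Pi_e$ on $\mathbb{R}^2$ with density $\lambda_e$, and they collude. Let $$P_{\mathrm{rx},e}=P_\ell\sum_{e\in\Pi_e}|e|^{-2b},\qquad \mathcal R_s=\Bigl[\log_2\Bigl(1+\frac{P_\ell}{r_\ell^{2b}\sigma_\ell^2}\Bigr)-\log_2\Bigl(1+\frac{P_{\mathrm{rx},e}}{\sigma_e^2}\Bigr)\Bigr]^+$$ be the aggregate power received by the eavesdroppers and the maximum secrecy rate (MSR) of the legitimate link, where $[x]^+=\max\{x,0\}$, and let $\mathcal R_\ell=\log_2\bigl(1+\frac{P_\ell}{r_\ell^{2b}\sigma_\ell^2}\bigr)$ be the capacity of the legitimate channel. For $0<\alpha<1$ put $\mathcal C_\alpha=\frac{1-\alpha}{\Gamma(2-\alpha)\cos(\pi\alpha/2)}$.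 For $\alpha\in(0,2]$, $\alpha\ne1$, $\beta\in[-1,1]$, $\gamma\ge0$, let $\mathcal S(\alpha,\beta,\gamma)$ be the stable distribution on $\mathbb{R}$ with characteristic function $\phi(w)=\exp\bigl(-\gamma|w|^\alpha[1-i\beta\,\mathrm{sign}(w)\tan(\pi\alpha/2)]\bigr)$. Then the series defining $P_{\mathrm{rx},e}$ converges almost surely and, with $\gamma=\pi\lambda_e\mathcal C_{1/b}^{-1}P_\ell^{1/b}$, $$P_{\mathrm{rx},e}\sim\mathcal S\bigl(\tfrac1b,\,1,\,\gamma\bigr),\qquad P_{\mathrm{rx},e}\,\gamma^{-b}\sim\mathcal S\bigl(\tfrac1b,\,1,\,1\bigr).$$ Moreover $\mathcal R_s$ is a random variable with cumulative distribution function $$F_{\mathcal R_s}(\varrho)=\begin{cases}0,&\varrho<0,\\[2pt] 1-F_{\widetilde P}\!\left(\dfrac{\bigl(1+\frac{P_\ell}{r_\ell^{2b}\sigma_\ell^2}\bigr)2^{-\varrho}-1}{(\pi\lambda_e\mathcal C_{1/b}^{-1})^b\,\frac{P_\ell}{\sigma_e^2}}\right),&0\le\varrho<\mathcal R_\ell,\\[10pt]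 1,&\varrho\ge\mathcal R_\ell,\end{cases}$$ where $F_{\widetilde P}$ is the cumulative distribution function of $\widetilde P\sim\mathcal S(\tfrac1b,1,1)$. -/

import Mathlib

open MeasureTheory ProbabilityTheory

/-- The Euclidean plane, with its Euclidean norm and Lebesgue measure (area). -/
abbrev Plane : Type := EuclideanSpace ℝ (Fin 2)

/-- `Pts : Ω → Set Plane` is a homogeneous Poisson point process with density `lam` (points per unit
area) under `P`: the number of points in a Borel set of finite area `|B|` is a Poisson random
variable with mean `lam * |B|`, and the numbers of points in finitely many pairwise disjoint such
sets are independent. -/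
structure IsPoissonProcess {Ω : Type*} [MeasurableSpace Ω] (P : Measure Ω)
    (lam : ℝ) (Pts : Ω → Set Plane) : Prop where
  law_count : ∀ B : Set Plane, MeasurableSet B → volume B < ⊤ →
    HasLaw (fun ω => (Pts ω ∩ B).encard)
      ((poissonMeasure (ENNReal.ofReal lam * volume B).toNNReal).map (Nat.cast : ℕ → ℕ∞)) P
  indep_count : ∀ (n : ℕ) (B : Fin n → Set Plane),
    (∀ i, MeasurableSet (B i)) → (∀ i, volume (B i) < ⊤) →
    Pairwise (fun i j => Disjoint (B i) (B j)) →
    iIndepFun (fun i ω => (Pts ω ∩ B i).encard) P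

/-- The power gain `g(r) = 1 / r^(2b)` of a link of length `r`. -/
noncomputable def pathGain (b r : ℝ) : ℝ := 1 / r ^ (2 * b)

/-- The aggregate power `Pl * ∑ g(|e|)` received by the colluding eavesdroppers `e ∈ S` from a
transmitter of power `Pl` at the origin. -/
noncomputable def aggregatePower (Pl : ℝ) (g : ℝ → ℝ) (S : Set Plane) : ℝ :=
  Pl * ∑' e : S, g ‖(e : Plane)‖

/-- The capacity (bits per complex dimension) of a Gaussian channel with received power `p` and
noise power `noise`. -/
noncomputable def gaussianCapacity (p noise : ℝ) : ℝ := Real.logb 2 (1 + p / noise)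

/-- The maximum secrecy rate of a legitimate link of length `rl` in the presence of colluding
eavesdroppers located at the points of `S`, for transmit power `Pl`, gain function `g`, and noise
powers `σl ^ 2` (legitimate receiver) and `σe ^ 2` (eavesdroppers). -/
noncomputable def maxSecrecyRate (Pl σl σe : ℝ) (g : ℝ → ℝ) (rl : ℝ) (S : Set Plane) : ℝ :=
  max (gaussianCapacity (Pl * g rl) (σl ^ 2)
    - gaussianCapacity (aggregatePower Pl g S) (σe ^ 2)) 0

/-- The characteristic function of the real stable distribution `S(α, β, γ)` with characteristic
exponent `α`, skewness `β` and dispersion `γ`. -/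
noncomputable def stableCharFun (α β γ w : ℝ) : ℂ :=
  if α = 1 then
    Complex.exp (-((γ * |w| : ℝ) : ℂ) *
      (1 + Complex.I * ((2 / Real.pi * β * Real.sign w * Real.log |w| : ℝ) : ℂ)))
  else
    Complex.exp (-((γ * |w| ^ α : ℝ) : ℂ) *
      (1 - Complex.I * ((β * Real.sign w * Real.tan (Real.pi * α / 2) : ℝ) : ℂ)))

/-- `ν` is the stable distribution `S(α, β, γ)` on the real line. -/
structure IsStableLaw (α β γ : ℝ) (ν : Measure ℝ) : Prop where
  exponent_mem : α ∈ Set.Ioc (0 : ℝ) 2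
  skewness_mem : β ∈ Set.Icc (-1 : ℝ) 1
  dispersion_nonneg : 0 ≤ γ
  isProbabilityMeasure : IsProbabilityMeasure ν
  charFun_eq : ∀ w : ℝ, charFun ν w = stableCharFun α β γ w

/-- The constant `C_α = (1 - α) / (Γ(2 - α) cos(π α / 2))`. -/
noncomputable def stableConst (α : ℝ) : ℝ :=
  (1 - α) / (Real.Gamma (2 - α) * Real.cos (Real.pi * α / 2))

open Set Filter Topology

/-! The gain depends on a point only through its squared norm, and the annulus of squared norms in
`(s, t]` has area `π (t - s)`. So the squared norms behave like a Poisson process of rate `π λ` on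
the half-line, and the received power is `Pl` times a sum of `t ^ (-b)` over it. Campbell's formula
gives the logarithm of the characteristic function of that sum as `-π λ ∫₀^∞ (1 - exp (i w t ^
(-b))) dt`. The integral is computed in `integral_one_sub_cexp_rpow_neg`: the substitution `t = u ^
(-1/b)` turns it into a Gamma-type integral, known on the positive axis and continued to the
imaginary axis. Campbell's formula is proved in the case needed, in `charFun_tsum_pathGain`: the
gain is replaced by step functions of the squared norm, whose sums are finite combinations of
independent Poisson counts, and both sides pass to the limit by dominated convergence. For the
secrecy rate, `R_s ≤ ϱ` is the event that the power reaches a threshold. Its probability is `1 - F`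
at the normalized threshold because the stable law has no atoms, its characteristic function being
integrable. -/

/-! ### The Lévy exponent: a Gamma integral and its analytic continuation -/

lemma norm_one_sub_cexp_neg_le {z : ℂ} (hz : 0 ≤ z.re) :
    ‖1 - Complex.exp (-z)‖ ≤ 2 * min 1 ‖z‖ := by
  rcases le_total ‖z‖ 1 with h | h
  · rw [min_eq_right h, norm_sub_rev]
    simpa using Complex.norm_exp_sub_one_le (x := -z) (by simpa using h)
  · rw [min_eq_left h]
    refine (norm_sub_le _ _).trans ?_
    have : ‖Complex.exp (-z)‖ ≤ 1 := by
      rw [Complex.norm_exp]; exact Real.exp_le_one_iff.2 (by simpa using hz)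
    rw [norm_one]; linarith

lemma integrableOn_min_one_mul_rpow {a : ℝ} (ha : 0 < a) (ha1 : a < 1) (K : ℝ) (hK : 0 ≤ K) :
    IntegrableOn (fun u : ℝ => min 1 (K * u) * u ^ (-a - 1)) (Ioi 0) := by
  have hmeas : Measurable (fun u : ℝ => min 1 (K * u) * u ^ (-a - 1)) := by fun_prop
  rw [← Ioc_union_Ioi_eq_Ioi zero_le_one]
  refine IntegrableOn.union ?_ ?_
  · have h : IntegrableOn (fun u : ℝ => K * u ^ (-a)) (Ioc 0 1) :=
      ((intervalIntegrable_iff_integrableOn_Ioc_of_le zero_le_one).1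
        (intervalIntegral.intervalIntegrable_rpow' (by linarith))).const_mul K
    refine h.mono' hmeas.aestronglyMeasurable ?_
    filter_upwards [ae_restrict_mem measurableSet_Ioc] with u hu
    have hu0 : 0 < u := hu.1
    rw [Real.norm_of_nonneg (by positivity)]
    have : u ^ (-a) = u * u ^ (-a - 1) := by
      rw [Real.rpow_sub_one hu0.ne']; field_simp
    rw [this, ← mul_assoc]
    gcongr
    exact min_le_right _ _
  · have h : IntegrableOn (fun u : ℝ => u ^ (-a - 1)) (Ioi 1) :=
      integrableOn_Ioi_rpow_of_lt (by linarith) zero_lt_one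
    refine h.mono' hmeas.aestronglyMeasurable ?_
    filter_upwards [ae_restrict_mem measurableSet_Ioi] with u hu
    have hu0 : 0 < u := zero_lt_one.trans hu
    rw [Real.norm_of_nonneg (by positivity)]
    exact mul_le_of_le_one_left (by positivity) (min_le_left _ _)

lemma norm_one_sub_cexp_neg_mul_rpow_le {z : ℂ} {K : ℝ} (hz : 0 ≤ z.re) (hK : ‖z‖ ≤ K) (c : ℝ)
    {u : ℝ} (hu : 0 < u) :
    ‖(1 - Complex.exp (-(z * u))) * ((u ^ c : ℝ) : ℂ)‖ ≤ 2 * (min 1 (K * u) * u ^ c) := by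
  rw [norm_mul, Complex.norm_real, Real.norm_of_nonneg (by positivity), ← mul_assoc]
  gcongr
  refine (norm_one_sub_cexp_neg_le (by simpa using mul_nonneg hz hu.le)).trans ?_
  rw [norm_mul, Complex.norm_real, Real.norm_of_nonneg hu.le]
  gcongr

lemma measurable_one_sub_cexp_mul_rpow (z : ℂ) (c : ℝ) :
    Measurable fun u : ℝ => (1 - Complex.exp (-(z * u))) * ((u ^ c : ℝ) : ℂ) := by
  fun_prop

lemma integrableOn_one_sub_cexp_mul_rpow {a : ℝ} (ha : 0 < a) (ha1 : a < 1) {z : ℂ}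
    (hz : 0 ≤ z.re) :
    IntegrableOn (fun u : ℝ => (1 - Complex.exp (-(z * u))) * ((u ^ (-a - 1) : ℝ) : ℂ))
      (Ioi 0) := by
  refine ((integrableOn_min_one_mul_rpow ha ha1 ‖z‖ (norm_nonneg _)).const_mul 2).mono'
    (measurable_one_sub_cexp_mul_rpow _ _).aestronglyMeasurable ?_
  filter_upwards [ae_restrict_mem measurableSet_Ioi] with u hu
  exact norm_one_sub_cexp_neg_mul_rpow_le hz le_rfl _ hu

/-- Integration by parts against `-u ^ (-a) / a` leaves a Gamma integral. The boundary terms vanish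
since `1 - exp (-x u)` is at most `x u` (at `0`, with `a < 1`) and at most `1` (at infinity, with `a
> 0`). -/
lemma integral_one_sub_exp_neg_mul_rpow {a : ℝ} (ha : 0 < a) (ha1 : a < 1) {x : ℝ} (hx : 0 < x) :
    ∫ u in Ioi (0 : ℝ), (1 - Real.exp (-(x * u))) * u ^ (-a - 1) =
      Real.Gamma (1 - a) / a * x ^ a := by
  have hbound : ∀ t : ℝ, 0 < t → 0 ≤ 1 - Real.exp (-(x * t)) ∧ 1 - Real.exp (-(x * t)) ≤ 1 ∧
      1 - Real.exp (-(x * t)) ≤ x * t := fun t ht => by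
    refine ⟨?_, ?_, ?_⟩
    · have : Real.exp (-(x * t)) ≤ 1 := Real.exp_le_one_iff.2 (by nlinarith)
      linarith
    · linarith [Real.exp_pos (-(x * t))]
    · linarith [Real.one_sub_le_exp_neg (x * t)]
  have hv : ∀ t ∈ Ioi (0 : ℝ), HasDerivAt (fun t : ℝ => -(t ^ (-a) / a)) (t ^ (-a - 1)) t := by
    intro t ht
    exact ((Real.hasDerivAt_rpow_const (p := -a) (Or.inl (ne_of_gt ht))).div_const a).fun_neg.congr_deriv
      (by field_simp)
  have hu : ∀ t ∈ Ioi (0 : ℝ), HasDerivAt (fun t : ℝ => 1 - Real.exp (-(x * t)))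
      (x * Real.exp (-(x * t))) t := by
    intro t _
    exact ((((hasDerivAt_id' t).const_mul x).fun_neg).exp.const_sub 1).congr_deriv (by ring)
  have huv' : IntegrableOn ((fun t : ℝ => 1 - Real.exp (-(x * t))) * fun t => t ^ (-a - 1))
      (Ioi 0) := by
    have := (integrableOn_one_sub_cexp_mul_rpow ha ha1 (z := (x : ℂ)) (by simpa using hx.le)).re
    refine this.congr (ae_of_all _ fun u => ?_)
    simp only [Pi.mul_apply]
    norm_cast
  have hu'v : IntegrableOn ((fun t : ℝ => x * Real.exp (-(x * t))) * fun t => -(t ^ (-a) / a))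
      (Ioi 0) := by
    have := (integrableOn_rpow_mul_exp_neg_mul_rpow (s := -a) (p := 1) (b := x) (by linarith)
      zero_lt_one hx).const_mul (-(x / a))
    refine this.congr (ae_of_all _ fun u => ?_)
    simp only [Pi.mul_apply, Real.rpow_one]
    ring_nf
  have h0 : Tendsto ((fun t : ℝ => 1 - Real.exp (-(x * t))) * fun t => -(t ^ (-a) / a))
      (𝓝[>] 0) (𝓝 0) := by
    have hlim : Tendsto (fun t : ℝ => x / a * t ^ (1 - a)) (𝓝[>] 0) (𝓝 0) := by
      have : Tendsto (fun t : ℝ => x / a * t ^ (1 - a)) (𝓝 0) (𝓝 (x / a * (0 : ℝ) ^ (1 - a))) :=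
        ((Real.continuousAt_rpow_const 0 (1 - a) (Or.inr (by linarith))).tendsto).const_mul _
      rw [Real.zero_rpow (by linarith), mul_zero] at this
      exact this.mono_left nhdsWithin_le_nhds
    refine squeeze_zero_norm' ?_ hlim
    filter_upwards [self_mem_nhdsWithin] with t ht
    have ht0 : 0 < t := ht
    obtain ⟨h1, h2, h3⟩ := hbound t ht0
    rw [Pi.mul_apply, norm_mul, norm_neg, Real.norm_of_nonneg h1,
      Real.norm_of_nonneg (by positivity)]
    calc _ ≤ x * t * (t ^ (-a) / a) := by gcongr
      _ = x / a * t ^ (1 - a) := by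
        rw [sub_eq_add_neg, Real.rpow_add ht0, Real.rpow_one]; ring
  have hinf : Tendsto ((fun t : ℝ => 1 - Real.exp (-(x * t))) * fun t => -(t ^ (-a) / a))
      atTop (𝓝 0) := by
    have hlim : Tendsto (fun t : ℝ => t ^ (-a) / a) atTop (𝓝 0) := by
      simpa using (tendsto_rpow_neg_atTop ha).div_const a
    refine squeeze_zero_norm' ?_ hlim
    filter_upwards [eventually_gt_atTop 0] with t ht0
    obtain ⟨h1, h2, h3⟩ := hbound t ht0
    rw [Pi.mul_apply, norm_mul, norm_neg, Real.norm_of_nonneg h1,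
      Real.norm_of_nonneg (by positivity)]
    exact mul_le_of_le_one_left (by positivity) h2
  rw [integral_Ioi_mul_deriv_eq_deriv_mul hu hv huv' hu'v h0 hinf]
  have hΓ := Real.integral_rpow_mul_exp_neg_mul_Ioi (a := 1 - a) (by linarith) hx
  have : ∀ t : ℝ, x * Real.exp (-(x * t)) * -(t ^ (-a) / a) =
      -(x / a) * (t ^ (1 - a - 1) * Real.exp (-(x * t))) := fun t => by
    rw [show 1 - a - 1 = -a by ring]; ring
  simp_rw [this]
  rw [integral_const_mul, hΓ, one_div, Real.inv_rpow hx.le, ← Real.rpow_neg hx.le,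
    show -(1 - a) = a - 1 by ring, Real.rpow_sub_one hx.ne']
  field_simp
  ring

lemma differentiableOn_integral_one_sub_cexp {a : ℝ} (ha : 0 < a) (ha1 : a < 1) :
    DifferentiableOn ℂ
      (fun z : ℂ => ∫ u in Ioi (0 : ℝ), (1 - Complex.exp (-(z * u))) * ((u ^ (-a - 1) : ℝ) : ℂ))
      {z | 0 < z.re} := by
  intro z hz
  have hz : 0 < z.re := hz
  -- On the half-plane `c < re y` the `y`-derivative of the integrand is dominated by `u ^ (-a) *
  -- exp (-c u)`, uniformly in `y`.
  set c := z.re / 2 with hc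
  have hs : {y : ℂ | c < y.re} ∈ 𝓝 z :=
    (isOpen_lt continuous_const Complex.continuous_re).mem_nhds (by simp [hc]; linarith)
  have h := hasDerivAt_integral_of_dominated_loc_of_deriv_le (μ := volume.restrict (Ioi (0 : ℝ)))
    (F := fun (z : ℂ) (u : ℝ) => (1 - Complex.exp (-(z * u))) * ((u ^ (-a - 1) : ℝ) : ℂ))
    (F' := fun (z : ℂ) (u : ℝ) => (u * Complex.exp (-(z * u))) * ((u ^ (-a - 1) : ℝ) : ℂ))
    (bound := fun u => u ^ (-a) * Real.exp (-c * u ^ (1 : ℝ)))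
    hs (Eventually.of_forall fun y => (measurable_one_sub_cexp_mul_rpow _ _).aestronglyMeasurable)
    (integrableOn_one_sub_cexp_mul_rpow ha ha1 hz.le)
    (by fun_prop) ?_
    (integrableOn_rpow_mul_exp_neg_mul_rpow (by linarith) zero_lt_one (by positivity)) ?_
  · exact h.2.differentiableAt.differentiableWithinAt
  · filter_upwards [ae_restrict_mem measurableSet_Ioi] with u hu y hy
    have hu0 : 0 < u := hu
    have hy : c < y.re := hy
    have e : u ^ (-a) = u * u ^ (-a - 1) := by
      rw [Real.rpow_sub_one hu0.ne']; field_simp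
    rw [norm_mul, norm_mul, Complex.norm_real, Complex.norm_real, Real.norm_of_nonneg hu0.le,
      Real.norm_of_nonneg (by positivity), Complex.norm_exp, e, Real.rpow_one, mul_right_comm]
    gcongr
    simp
    nlinarith
  · refine ae_of_all _ fun u y _ => ?_
    exact ((((hasDerivAt_id' y).mul_const (u : ℂ)).fun_neg.cexp.const_sub 1).mul_const
      ((u ^ (-a - 1) : ℝ) : ℂ)).congr_deriv (by ring)

/-- Identity theorem: both sides are holomorphic on the right half-plane and agree at real points
accumulating at `1`. -/
lemma integral_one_sub_cexp_neg_mul_rpow_of_pos {a : ℝ} (ha : 0 < a) (ha1 : a < 1) {z : ℂ}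
    (hz : 0 < z.re) :
    ∫ u in Ioi (0 : ℝ), (1 - Complex.exp (-(z * u))) * ((u ^ (-a - 1) : ℝ) : ℂ) =
      (Real.Gamma (1 - a) / a : ℝ) * z ^ (a : ℂ) := by
  have hopen : IsOpen {z : ℂ | 0 < z.re} := isOpen_lt continuous_const Complex.continuous_re
  have hg : DifferentiableOn ℂ (fun z : ℂ => ((Real.Gamma (1 - a) / a : ℝ) : ℂ) * z ^ (a : ℂ))
      {z | 0 < z.re} := by
    intro y hy
    have hy : y ∈ Complex.slitPlane := Or.inl hy
    exact (((differentiableAt_id).cpow_const hy).const_mul _).differentiableWithinAt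
  refine AnalyticOnNhd.eqOn_of_preconnected_of_frequently_eq (z₀ := 1)
    ((differentiableOn_integral_one_sub_cexp ha ha1).analyticOnNhd hopen)
    (hg.analyticOnNhd hopen) (convex_halfSpace_re_gt 0).isPreconnected (by simp) ?_ hz
  have hreal : ∀ x : ℝ, 0 < x →
      ∫ u in Ioi (0 : ℝ), (1 - Complex.exp (-((x : ℂ) * u))) * ((u ^ (-a - 1) : ℝ) : ℂ) =
      (Real.Gamma (1 - a) / a : ℝ) * (x : ℂ) ^ (a : ℂ) := by
    intro x hx
    rw [← Complex.ofReal_cpow hx.le, ← Complex.ofReal_mul,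
      ← integral_one_sub_exp_neg_mul_rpow ha ha1 hx, ← integral_complex_ofReal]
    congr 1; ext u; push_cast; rfl
  have htend : Tendsto (fun x : ℝ => (x : ℂ)) (𝓝[>] 1) (𝓝[≠] 1) := by
    refine tendsto_nhdsWithin_iff.2 ⟨?_, ?_⟩
    · exact (Complex.continuous_ofReal.tendsto' 1 1 (by simp)).mono_left nhdsWithin_le_nhds
    · filter_upwards [self_mem_nhdsWithin] with x hx
      have : (1 : ℝ) < x := hx
      simpa using this.ne'
  refine htend.frequently (Eventually.frequently ?_)
  filter_upwards [self_mem_nhdsWithin] with x hx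
  exact hreal x (zero_lt_one.trans hx)

/-- The case needed is `z = -i w`, on the boundary. It is reached from `z + ε` by dominated
convergence; a nonzero `z` of the closed half-plane avoids the cut, so the power is continuous
there. -/
lemma integral_one_sub_cexp_neg_mul_rpow {a : ℝ} (ha : 0 < a) (ha1 : a < 1) {z : ℂ}
    (hz : 0 ≤ z.re) (hz0 : z ≠ 0) :
    ∫ u in Ioi (0 : ℝ), (1 - Complex.exp (-(z * u))) * ((u ^ (-a - 1) : ℝ) : ℂ) =
      (Real.Gamma (1 - a) / a : ℝ) * z ^ (a : ℂ) := by
  have hslit : z ∈ Complex.slitPlane := by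
    rcases hz.lt_or_eq with h | h
    · exact Or.inl h
    · exact Or.inr fun him => hz0 (Complex.ext h.symm him)
  have hz' : Tendsto (fun ε : ℝ => z + ε) (𝓝[>] 0) (𝓝 z) := by
    have : Continuous fun ε : ℝ => z + ε := by fun_prop
    exact (this.tendsto' 0 z (by simp)).mono_left nhdsWithin_le_nhds
  have h1 : Tendsto (fun ε : ℝ => ∫ u in Ioi (0 : ℝ), (1 - Complex.exp (-((z + ε) * u))) *
      ((u ^ (-a - 1) : ℝ) : ℂ)) (𝓝[>] 0)
      (𝓝 (∫ u in Ioi (0 : ℝ), (1 - Complex.exp (-(z * u))) * ((u ^ (-a - 1) : ℝ) : ℂ))) := by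
    refine tendsto_integral_filter_of_dominated_convergence
      (fun u => 2 * (min 1 ((‖z‖ + 1) * u) * u ^ (-a - 1)))
      (Eventually.of_forall fun y => (measurable_one_sub_cexp_mul_rpow _ _).aestronglyMeasurable)
      ?_ ((integrableOn_min_one_mul_rpow ha ha1 _ (by positivity)).const_mul 2) ?_
    · filter_upwards [Ioo_mem_nhdsGT zero_lt_one] with ε hε
      filter_upwards [ae_restrict_mem measurableSet_Ioi] with u hu
      refine norm_one_sub_cexp_neg_mul_rpow_le ?_ ?_ _ hu
      · simpa using add_nonneg hz hε.1.le
      · refine (norm_add_le _ _).trans ?_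
        rw [Complex.norm_real, Real.norm_of_nonneg hε.1.le]
        gcongr
        exact hε.2.le
    · refine ae_of_all _ fun u => ?_
      have : Continuous fun y : ℂ => (1 - Complex.exp (-(y * u))) * ((u ^ (-a - 1) : ℝ) : ℂ) := by
        fun_prop
      exact (this.tendsto z).comp hz'
  have h2 : Tendsto (fun ε : ℝ => ((Real.Gamma (1 - a) / a : ℝ) : ℂ) * (z + ε) ^ (a : ℂ)) (𝓝[>] 0)
      (𝓝 ((Real.Gamma (1 - a) / a : ℝ) * z ^ (a : ℂ))) :=
    (((continuousAt_id (x := z)).cpow continuousAt_const hslit).tendsto.comp hz').const_mul _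
  refine tendsto_nhds_unique (h1.congr' ?_) h2
  filter_upwards [self_mem_nhdsWithin] with ε hε
  have hε : 0 < ε := hε
  exact integral_one_sub_cexp_neg_mul_rpow_of_pos ha ha1 (by simpa using by linarith)

lemma neg_ofReal_mul_I_cpow (a : ℝ) {w : ℝ} (hw : w ≠ 0) :
    (-((w : ℂ) * Complex.I)) ^ (a : ℂ) = ((|w| ^ a : ℝ) : ℂ) *
      Complex.exp (-(Complex.I * ((Real.pi * a / 2 * Real.sign w : ℝ) : ℂ))) := by
  have hne : -((w : ℂ) * Complex.I) ≠ 0 := by simpa using hw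
  have habs : 0 < |w| := abs_pos.2 hw
  rw [Complex.cpow_def_of_ne_zero hne, Complex.log, Real.rpow_def_of_pos habs, Complex.ofReal_exp,
    ← Complex.exp_add]
  have hn : ‖-((w : ℂ) * Complex.I)‖ = |w| := by simp
  have harg : Complex.arg (-((w : ℂ) * Complex.I)) = -(Real.pi / 2 * Real.sign w) := by
    rcases lt_or_gt_of_ne hw with h | h
    · rw [show -((w : ℂ) * Complex.I) = ((-w : ℝ) : ℂ) * Complex.I by push_cast; ring,
        Complex.arg_real_mul _ (by linarith), Complex.arg_I, Real.sign_of_neg h]; ring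
    · rw [show -((w : ℂ) * Complex.I) = (w : ℂ) * (-Complex.I) by ring,
        Complex.arg_real_mul _ h, Complex.arg_neg_I, Real.sign_of_pos h]; ring
  rw [hn, harg]
  congr 1
  push_cast
  ring

lemma integral_one_sub_cexp_rpow_neg {b : ℝ} (hb : 1 < b) (w : ℝ) :
    ∫ t in Ioi (0 : ℝ), (1 - Complex.exp (((w * t ^ (-b) : ℝ) : ℂ) * Complex.I)) =
      ((stableConst (1 / b))⁻¹ * |w| ^ (1 / b) : ℝ) *
        (1 - Complex.I * ((Real.sign w * Real.tan (Real.pi * (1 / b) / 2) : ℝ) : ℂ)) := by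
  have hb0 : 0 < b := by linarith
  set a := 1 / b with ha_def
  have ha : 0 < a := by positivity
  have ha1 : a < 1 := by rw [ha_def, div_lt_one hb0]; exact hb
  set g : ℝ → ℂ := fun t => 1 - Complex.exp (((w * t ^ (-b) : ℝ) : ℂ) * Complex.I) with hg
  -- Substitution `t = x ^ (-a)`: since `a * b = 1`, `t ^ (-b)` becomes `x`, and the Jacobian
  -- supplies the weight `x ^ (-a - 1)`.
  have hcomp : ∀ x ∈ Ioi (0 : ℝ), (|-a| * x ^ (-a - 1)) • g (x ^ (-a)) =
      (a : ℂ) * ((1 - Complex.exp (-(-((w : ℂ) * Complex.I) * x))) *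
        ((x ^ (-a - 1) : ℝ) : ℂ)) := by
    intro x hx
    have hx0 : 0 < x := hx
    have : (x ^ (-a)) ^ (-b) = x := by
      rw [← Real.rpow_mul hx0.le, show -a * -b = 1 by rw [ha_def]; field_simp, Real.rpow_one]
    simp only [hg, this, abs_neg, abs_of_pos ha, Complex.real_smul]
    push_cast
    ring_nf
  have hre : 0 ≤ (-((w : ℂ) * Complex.I)).re := by simp
  rw [← integral_comp_rpow_Ioi g (neg_ne_zero.2 ha.ne'),
    setIntegral_congr_fun measurableSet_Ioi hcomp, integral_const_mul]
  rcases eq_or_ne w 0 with rfl | hw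
  · simp [Real.zero_rpow ha.ne']
  rw [integral_one_sub_cexp_neg_mul_rpow ha ha1 hre (by simpa using hw),
    neg_ofReal_mul_I_cpow a hw]
  set θ := Real.pi * a / 2 with hθ
  have hcos : 0 < Real.cos θ := Real.cos_pos_of_mem_Ioo
    ⟨by rw [hθ]; nlinarith [Real.pi_pos], by rw [hθ]; nlinarith [Real.pi_pos]⟩
  -- Factoring out `cos θ` produces the skewness term `tan θ`; this cosine joins `Γ(1 - a)` to form
  -- the inverse of the stable constant.
  have hexp : Complex.exp (-(Complex.I * ((θ * Real.sign w : ℝ) : ℂ))) =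
      (Real.cos θ : ℂ) * (1 - Complex.I * ((Real.sign w * Real.tan θ : ℝ) : ℂ)) := by
    rw [show -(Complex.I * ((θ * Real.sign w : ℝ) : ℂ)) =
      ((-(θ * Real.sign w) : ℝ) : ℂ) * Complex.I by push_cast; ring, Complex.exp_mul_I,
      ← Complex.ofReal_cos, ← Complex.ofReal_sin, Real.tan_eq_sin_div_cos]
    rcases lt_or_gt_of_ne hw with h | h
    · rw [Real.sign_of_neg h]
      push_cast
      have : Complex.cos (θ : ℂ) ≠ 0 := by exact_mod_cast hcos.ne'
      field_simp
      simp
    · rw [Real.sign_of_pos h]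
      push_cast
      have : Complex.cos (θ : ℂ) ≠ 0 := by exact_mod_cast hcos.ne'
      field_simp
      simp
      ring
  have hconst : (stableConst a)⁻¹ = Real.Gamma (1 - a) * Real.cos θ := by
    rw [stableConst, inv_div, show 2 - a = 1 - a + 1 by ring,
      Real.Gamma_add_one (by linarith)]
    have : 1 - a ≠ 0 := by linarith
    field_simp
    rw [hθ, mul_comm Real.pi a, mul_comm]
  rw [hexp, hconst]
  have : (a : ℂ) ≠ 0 := by exact_mod_cast ha.ne'
  push_cast
  field_simp

open scoped NNReal ENNReal

/-! ### Poisson counts: means, null events and characteristic functions -/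

lemma lintegral_natCast_poissonMeasure (r : ℝ≥0) :
    ∫⁻ n : ℕ, (n : ℝ≥0∞) ∂(poissonMeasure r) = r := by
  rw [poissonMeasure, lintegral_sum_measure]
  simp only [lintegral_smul_measure, lintegral_dirac, smul_eq_mul]
  rw [tsum_eq_zero_add' ENNReal.summable]
  have h : ∀ n : ℕ, ENNReal.ofReal (Real.exp (-r) * r ^ (n + 1) / (n + 1).factorial) *
      ((n + 1 : ℕ) : ℝ≥0∞) = r * ENNReal.ofReal (Real.exp (-r) * r ^ n / n.factorial) := fun n => by
    rw [← ENNReal.ofReal_natCast, ← ENNReal.ofReal_coe_nnreal, ← ENNReal.ofReal_mul (by positivity),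
      ← ENNReal.ofReal_mul (by positivity), Nat.factorial_succ]
    congr 1
    push_cast
    field_simp
    ring
  simp_rw [h]
  rw [ENNReal.tsum_mul_left, ← ENNReal.ofReal_tsum_of_nonneg (fun n => by positivity)
    (hasSum_one_poissonMeasure r).summable, (hasSum_one_poissonMeasure r).tsum_eq]
  simp

namespace IsPoissonProcess

variable {Ω : Type*} [MeasurableSpace Ω] {P : Measure Ω} {lam : ℝ} {Pts : Ω → Set Plane}

lemma lintegral_encard (h : IsPoissonProcess P lam Pts) {B : Set Plane} (hB : MeasurableSet B)
    (hvol : volume B < ⊤) :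
    ∫⁻ ω, ((Pts ω ∩ B).encard : ℝ≥0∞) ∂P = ENNReal.ofReal lam * volume B := by
  have hlaw := h.law_count B hB hvol
  rw [← lintegral_map' (f := fun n : ℕ∞ => (n : ℝ≥0∞)) (Measurable.of_discrete).aemeasurable
    hlaw.aemeasurable, hlaw.map_eq, lintegral_map Measurable.of_discrete Measurable.of_discrete]
  simp only [ENat.toENNReal_coe]
  rw [lintegral_natCast_poissonMeasure, ENNReal.coe_toNNReal]
  exact ENNReal.mul_ne_top ENNReal.ofReal_ne_top hvol.ne

lemma ae_finite (h : IsPoissonProcess P lam Pts) {B : Set Plane} (hB : MeasurableSet B)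
    (hvol : volume B < ⊤) : ∀ᵐ ω ∂P, (Pts ω ∩ B).Finite := by
  have hmeas : AEMeasurable (fun ω => ((Pts ω ∩ B).encard : ℝ≥0∞)) P :=
    (Measurable.of_discrete (f := fun n : ℕ∞ => (n : ℝ≥0∞))).comp_aemeasurable
      (h.law_count B hB hvol).aemeasurable
  have := ae_lt_top' hmeas (by
    rw [h.lintegral_encard hB hvol]; exact ENNReal.mul_ne_top ENNReal.ofReal_ne_top hvol.ne)
  filter_upwards [this] with ω hω
  rw [← Set.encard_lt_top_iff]
  simpa using hω

lemma ae_inter_eq_empty (h : IsPoissonProcess P lam Pts) {B : Set Plane} (hB : MeasurableSet B)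
    (hvol : volume B = 0) : ∀ᵐ ω ∂P, Pts ω ∩ B = ∅ := by
  have hmeas : AEMeasurable (fun ω => ((Pts ω ∩ B).encard : ℝ≥0∞)) P :=
    (Measurable.of_discrete (f := fun n : ℕ∞ => (n : ℝ≥0∞))).comp_aemeasurable
      (h.law_count B hB (by simp [hvol])).aemeasurable
  have := (lintegral_eq_zero_iff' hmeas).1 (by
    rw [h.lintegral_encard hB (by simp [hvol]), hvol, mul_zero])
  filter_upwards [this] with ω hω
  simpa using hω

lemma map_toNat_encard (h : IsPoissonProcess P lam Pts) {B : Set Plane} (hB : MeasurableSet B)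
    (hvol : volume B < ⊤) :
    P.map (fun ω => ((Pts ω ∩ B).encard.toNat : ℝ)) =
      (poissonMeasure (ENNReal.ofReal lam * volume B).toNNReal).map (Nat.cast : ℕ → ℝ) := by
  have hlaw := h.law_count B hB hvol
  have : (fun ω => ((Pts ω ∩ B).encard.toNat : ℝ)) =
      (fun n : ℕ∞ => (n.toNat : ℝ)) ∘ fun ω => (Pts ω ∩ B).encard := rfl
  rw [this, ← AEMeasurable.map_map_of_aemeasurable (Measurable.of_discrete).aemeasurable
    hlaw.aemeasurable, hlaw.map_eq, Measure.map_map Measurable.of_discrete Measurable.of_discrete]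
  congr 1

lemma charFun_sum_mul_encard (h : IsPoissonProcess P lam Pts) (hlam : 0 ≤ lam) {n : ℕ}
    {B : Fin n → Set Plane} (hB : ∀ i, MeasurableSet (B i)) (hvol : ∀ i, volume (B i) < ⊤)
    (hdisj : Pairwise fun i j => Disjoint (B i) (B j)) (c : Fin n → ℝ) (w : ℝ) :
    charFun (P.map fun ω => ∑ i, c i * ((Pts ω ∩ B i).encard.toNat : ℝ)) w =
      Complex.exp (∑ i, (lam * volume.real (B i) : ℝ) *
        (Complex.exp (((w * c i : ℝ) : ℂ) * Complex.I) - 1)) := by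
  have hmeas : ∀ i, AEMeasurable (fun ω => ((Pts ω ∩ B i).encard.toNat : ℝ)) P := fun i =>
    (Measurable.of_discrete (f := fun n : ℕ∞ => (n.toNat : ℝ))).comp_aemeasurable
      (h.law_count (B i) (hB i) (hvol i)).aemeasurable
  have hind : iIndepFun (fun i ω => c i * ((Pts ω ∩ B i).encard.toNat : ℝ)) P :=
    (h.indep_count n B hB hvol hdisj).comp (fun i (m : ℕ∞) => c i * (m.toNat : ℝ))
      fun i => Measurable.of_discrete
  rw [iIndepFun.charFun_map_fun_sum_eq_prod (fun i => (hmeas i).const_mul _) hind,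
    Finset.prod_apply, Complex.exp_sum]
  refine Finset.prod_congr rfl fun i _ => ?_
  rw [charFun_map_mul_comp (hmeas i), h.map_toNat_encard (hB i) (hvol i),
    charFun_map_cast_poissonMeasure, mul_comm (c i)]
  congr 2
  rw [ENNReal.coe_toNNReal_eq_toReal, ENNReal.toReal_mul, ENNReal.toReal_ofReal hlam]
  rfl

end IsPoissonProcess

/-! ### Annuli indexed by squared norm, and sums over points as counts -/

/-- The annulus of points of the plane whose squared norm lies in `(s, t]`. -/
def annulus (s t : ℝ) : Set Plane := {x | ‖x‖ ^ 2 ∈ Ioc s t}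

lemma mem_annulus {s t : ℝ} {x : Plane} : x ∈ annulus s t ↔ ‖x‖ ^ 2 ∈ Ioc s t := Iff.rfl

lemma measurableSet_annulus (s t : ℝ) : MeasurableSet (annulus s t) :=
  measurableSet_Ioc.preimage (by fun_prop : Measurable fun x : Plane => ‖x‖ ^ 2)

lemma volume_annulus {s t : ℝ} (hs : 0 ≤ s) (hst : s ≤ t) :
    volume (annulus s t) = ENNReal.ofReal (Real.pi * (t - s)) := by
  have hball : ∀ r : ℝ, 0 ≤ r → volume (Metric.closedBall (0 : Plane) (√r)) =
      ENNReal.ofReal (Real.pi * r) := fun r hr => by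
    rw [EuclideanSpace.volume_closedBall_fin_two, ← ENNReal.ofReal_pow (Real.sqrt_nonneg r),
      Real.sq_sqrt hr, ← ENNReal.ofReal_mul hr, mul_comm]
  have hmem : ∀ (r : ℝ) (x : Plane), x ∈ Metric.closedBall (0 : Plane) (√r) ↔ ‖x‖ ≤ √r := by
    intro r x; simp
  have : annulus s t = Metric.closedBall (0 : Plane) (√t) \ Metric.closedBall 0 (√s) := by
    ext x
    rw [mem_annulus, Set.mem_sdiff, hmem, hmem, not_le, Real.le_sqrt (norm_nonneg x) (hs.trans hst),
      Real.sqrt_lt hs (norm_nonneg x), and_comm]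
    rfl
  rw [this, measure_sdiff (Metric.closedBall_subset_closedBall (Real.sqrt_le_sqrt hst))
    Metric.isClosed_closedBall.measurableSet.nullMeasurableSet (by rw [hball s hs]; simp),
    hball s hs, hball t (hs.trans hst), ← ENNReal.ofReal_sub _ (by positivity), mul_sub]

lemma disjoint_annulus {s t s' t' : ℝ} (h : Disjoint (Ioc s t) (Ioc s' t')) :
    Disjoint (annulus s t) (annulus s' t') :=
  h.preimage _

lemma tsum_indicator_one_eq_encard {α : Type*} (S A : Set α) :
    ∑' e : S, A.indicator (fun _ => (1 : ℝ≥0∞)) e = (S ∩ A).encard := by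
  rw [← ENNReal.tsum_set_one, tsum_subtype S (A.indicator fun _ => (1 : ℝ≥0∞)),
    tsum_subtype (S ∩ A) (fun _ => (1 : ℝ≥0∞)), indicator_indicator]

lemma hasSum_indicator_one_toNat_encard {α : Type*} {S A : Set α} (h : (S ∩ A).Finite) :
    HasSum (fun e : S => A.indicator (fun _ => (1 : ℝ)) e) (S ∩ A).encard.toNat := by
  have := h.fintype
  have h1 : HasSum ((fun _ => (1 : ℝ)) ∘ ((↑) : ↥(S ∩ A) → α)) ((S ∩ A).encard.toNat : ℝ) := by
    rw [Set.encard, ENat.card_eq_coe_fintype_card, ENat.toNat_natCast]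
    simpa [Function.comp_def] using hasSum_fintype (fun _ : ↥(S ∩ A) => (1 : ℝ))
  rw [hasSum_subtype_iff_indicator, ← indicator_indicator, ← hasSum_subtype_iff_indicator] at h1
  exact h1

lemma pathGain_eq (b : ℝ) {r : ℝ} (hr : 0 ≤ r) : pathGain b r = (r ^ 2) ^ (-b) := by
  rw [pathGain, Real.rpow_neg (by positivity), Real.rpow_mul hr, one_div]
  norm_num

lemma pathGain_nonneg (b : ℝ) {r : ℝ} (hr : 0 ≤ r) : 0 ≤ pathGain b r := by
  rw [pathGain]; positivity

/-! ### Step functions and the Riemann sums of the exponent -/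

/-- The step function on `(0, n]` with mesh `1 / n` which takes on each interval of the mesh the
value of `F` at the right end point. -/
noncomputable def stepSum {E : Type*} [AddCommMonoid E] (F : ℝ → E) (n : ℕ) (t : ℝ) : E :=
  ∑ k : Fin (n ^ 2), (Ioc ((k : ℝ) / n) (((k : ℝ) + 1) / n)).indicator
    (fun _ => F (((k : ℝ) + 1) / n)) t

lemma mem_Ioc_div_iff {n k : ℕ} (hn : 0 < n) {t : ℝ} :
    t ∈ Ioc ((k : ℝ) / n) (((k : ℝ) + 1) / n) ↔ ⌈t * n⌉₊ = k + 1 := by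
  have hn' : (0 : ℝ) < n := by exact_mod_cast hn
  rw [Nat.ceil_eq_iff (by omega), mem_Ioc, div_lt_iff₀ hn', le_div_iff₀ hn']
  simp

lemma stepSum_eq {E : Type*} [AddCommMonoid E] (F : ℝ → E) {n : ℕ} (hn : 0 < n) {t : ℝ}
    (ht : 0 < t) : stepSum F n t = if t ≤ n then F (⌈t * n⌉₊ / n) else 0 := by
  have hn' : (0 : ℝ) < n := by exact_mod_cast hn
  have hpos : 0 < ⌈t * n⌉₊ := Nat.ceil_pos.2 (by positivity)
  have hle : t ≤ n ↔ ⌈t * n⌉₊ ≤ n ^ 2 := by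
    rw [Nat.ceil_le, Nat.cast_pow, sq, mul_le_mul_iff_left₀ hn']
  unfold stepSum
  split_ifs with h
  · rw [hle] at h
    have hk : ⌈t * n⌉₊ - 1 < n ^ 2 := by omega
    rw [Finset.sum_eq_single (⟨⌈t * n⌉₊ - 1, hk⟩ : Fin (n ^ 2))]
    · rw [indicator_of_mem ((mem_Ioc_div_iff hn).2 (by simp; omega))]
      congr 2
      rw [Nat.cast_sub hpos]
      simp
    · intro k _ hk'
      refine indicator_of_notMem (fun hmem => hk' ?_) _
      rw [mem_Ioc_div_iff hn] at hmem
      ext; simp; omega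
    · simp
  · refine Finset.sum_eq_zero fun k _ => indicator_of_notMem (fun hmem => h ?_) _
    rw [mem_Ioc_div_iff hn] at hmem
    rw [hle]; omega

lemma tendsto_stepSum {E : Type*} [NormedAddCommGroup E] {F : ℝ → E} {t : ℝ}
    (ht : 0 < t) (hF : ContinuousAt F t) : Tendsto (fun n => stepSum F n t) atTop (𝓝 (F t)) := by
  have h : Tendsto (fun n : ℕ => ((⌈t * n⌉₊ : ℝ) / n)) atTop (𝓝 t) :=
    (tendsto_nat_ceil_mul_div_atTop ht.le).comp tendsto_natCast_atTop_atTop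
  refine (hF.tendsto.comp h).congr' ?_
  filter_upwards [eventually_gt_atTop 0, eventually_ge_atTop ⌈t⌉₊] with n hn hn'
  rw [stepSum_eq F hn ht, if_pos (Nat.ceil_le.1 hn')]
  rfl

/-- This is why the right end point is sampled: it lies at or beyond `t`, so a decreasing envelope
of `F` also dominates every step function, even with a singularity at `0`. -/
lemma norm_stepSum_le {E : Type*} [NormedAddCommGroup E] {F : ℝ → E} {G : ℝ → ℝ}
    (hF : ∀ s, 0 < s → ‖F s‖ ≤ G s) (hG : AntitoneOn G (Ioi 0)) (n : ℕ) {t : ℝ} (ht : 0 < t) :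
    ‖stepSum F n t‖ ≤ G t := by
  have hGt : 0 ≤ G t := (norm_nonneg _).trans (hF t ht)
  rcases Nat.eq_zero_or_pos n with rfl | hn
  · simpa [stepSum] using hGt
  have hn' : (0 : ℝ) < n := by exact_mod_cast hn
  rw [stepSum_eq F hn ht]
  split_ifs
  · have hle : t ≤ ⌈t * n⌉₊ / n := by
      rw [le_div_iff₀ hn']; exact Nat.le_ceil _
    exact (hF _ (ht.trans_le hle)).trans (hG ht (ht.trans_le hle) hle)
  · simpa using hGt

lemma measurable_stepSum (F : ℝ → ℂ) (n : ℕ) : Measurable (stepSum F n) := by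
  unfold stepSum
  exact Finset.measurable_sum _ fun k _ => measurable_const.indicator measurableSet_Ioc

lemma integral_stepSum (F : ℝ → ℂ) (n : ℕ) :
    ∫ t in Ioi (0 : ℝ), stepSum F n t =
      ∑ k : Fin (n ^ 2), ((1 / n : ℝ) : ℂ) * F (((k : ℝ) + 1) / n) := by
  unfold stepSum
  have hsub : ∀ k : Fin (n ^ 2), Ioc ((k : ℝ) / n) (((k : ℝ) + 1) / n) ⊆ Ioi (0 : ℝ) := fun k t ht =>
    lt_of_le_of_lt (by positivity) ht.1
  rw [integral_finsetSum]
  · refine Finset.sum_congr rfl fun k _ => ?_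
    rw [setIntegral_indicator measurableSet_Ioc, inter_eq_self_of_subset_right (hsub k),
      setIntegral_const, Real.volume_real_Ioc_of_le (by gcongr; linarith), Complex.real_smul]
    congr 2
    ring
  · intro k _
    exact (integrable_indicator_iff measurableSet_Ioc).2
      (integrableOn_const (by
        refine ne_of_lt ((Measure.restrict_apply_le _ _).trans_lt ?_)
        simp))

lemma antitoneOn_min_one_mul_rpow_neg {b : ℝ} (hb : 0 < b) {K : ℝ} (hK : 0 ≤ K) :
    AntitoneOn (fun t : ℝ => 2 * min 1 (K * t ^ (-b))) (Ioi 0) := by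
  intro s hs t ht hst
  have := Real.rpow_le_rpow_of_nonpos hs hst (neg_nonpos.2 hb.le)
  dsimp only
  gcongr

lemma integrableOn_min_one_mul_rpow_neg {b : ℝ} (hb : 1 < b) {K : ℝ} (hK : 0 ≤ K) :
    IntegrableOn (fun t : ℝ => 2 * min 1 (K * t ^ (-b))) (Ioi 0) := by
  refine Integrable.const_mul ?_ 2
  have hmeas : Measurable fun t : ℝ => min 1 (K * t ^ (-b)) := by fun_prop
  rw [← IntegrableOn, ← Ioc_union_Ioi_eq_Ioi zero_le_one]
  refine IntegrableOn.union ?_ ?_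
  · refine (integrableOn_const (C := (1 : ℝ)) (by simp)).mono' hmeas.aestronglyMeasurable ?_
    filter_upwards [ae_restrict_mem measurableSet_Ioc] with t ht
    have ht0 : 0 < t := ht.1
    rw [Real.norm_of_nonneg (by positivity)]
    exact min_le_left _ _
  · refine ((integrableOn_Ioi_rpow_of_lt (a := -b) (by linarith) zero_lt_one).const_mul K).mono'
      hmeas.aestronglyMeasurable ?_
    filter_upwards [ae_restrict_mem measurableSet_Ioi] with t ht
    have ht0 : 0 < t := zero_lt_one.trans ht
    rw [Real.norm_of_nonneg (by positivity)]
    exact min_le_right _ _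

lemma tendsto_sum_cexp_sub_one {b : ℝ} (hb : 1 < b) (w : ℝ) :
    Tendsto (fun n : ℕ => ∑ k : Fin (n ^ 2), ((1 / n : ℝ) : ℂ) *
      (Complex.exp (((w * (((k : ℝ) + 1) / n) ^ (-b) : ℝ) : ℂ) * Complex.I) - 1)) atTop
      (𝓝 (-∫ t in Ioi (0 : ℝ), (1 - Complex.exp (((w * t ^ (-b) : ℝ) : ℂ) * Complex.I)))) := by
  set F : ℝ → ℂ := fun t => Complex.exp (((w * t ^ (-b) : ℝ) : ℂ) * Complex.I) - 1 with hF
  have hlim : Tendsto (fun n => ∫ t in Ioi (0 : ℝ), stepSum F n t) atTop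
      (𝓝 (∫ t in Ioi (0 : ℝ), F t)) := by
    refine tendsto_integral_of_dominated_convergence (fun t : ℝ => 2 * min 1 (|w| * t ^ (-b)))
      (fun n => (measurable_stepSum F n).aestronglyMeasurable)
      (integrableOn_min_one_mul_rpow_neg hb (abs_nonneg w)) (fun n => ?_) ?_
    · filter_upwards [ae_restrict_mem measurableSet_Ioi] with t ht
      refine norm_stepSum_le (fun s hs => ?_)
        (antitoneOn_min_one_mul_rpow_neg (by linarith) (abs_nonneg w)) n ht
      have := norm_one_sub_cexp_neg_le (z := -(((w * s ^ (-b) : ℝ) : ℂ) * Complex.I)) (by simp)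
      rw [neg_neg, norm_sub_rev, norm_neg, norm_mul, Complex.norm_I, mul_one, Complex.norm_real,
        norm_mul, Real.norm_eq_abs, Real.norm_of_nonneg (by positivity : 0 ≤ s ^ (-b))] at this
      exact this
    · filter_upwards [ae_restrict_mem measurableSet_Ioi] with t ht
      refine tendsto_stepSum ht ?_
      have h1 : ContinuousAt (fun t : ℝ => t ^ (-b)) t :=
        Real.continuousAt_rpow_const t (-b) (Or.inl (ne_of_gt ht))
      have h2 : Continuous fun y : ℝ => Complex.exp (((w * y : ℝ) : ℂ) * Complex.I) - 1 := by
        fun_prop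
      exact h2.continuousAt.comp h1
  simp_rw [integral_stepSum] at hlim
  rw [← integral_neg]
  simpa [hF] using hlim

/-! ### Convergence of the sum of gains and its characteristic function -/

namespace IsPoissonProcess

variable {Ω : Type*} [MeasurableSpace Ω] {P : Measure Ω} {lam : ℝ} {Pts : Ω → Set Plane}

/-- Outside the unit disc the expected sum is at most `λ π ∑ (k + 1) ^ (-b)`, finite as `b > 1`.
Inside, the mean may be infinite, but almost surely only finitely many points occur. -/
lemma ae_summable_pathGain (h : IsPoissonProcess P lam Pts) {b : ℝ} (hb : 1 < b) :
    ∀ᵐ ω ∂P, Summable (fun e : Pts ω => pathGain b ‖(e : Plane)‖) := by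
  have hvol : ∀ k : ℕ, volume (annulus ((k : ℝ) + 1) (k + 2)) = ENNReal.ofReal Real.pi :=
    fun k => by
      rw [volume_annulus (by positivity) (by linarith)]; congr 1; ring
  have hmeas : ∀ k : ℕ, AEMeasurable (fun ω => ENNReal.ofReal (((k : ℝ) + 1) ^ (-b)) *
      ((Pts ω ∩ annulus ((k : ℝ) + 1) (k + 2)).encard : ℝ≥0∞)) P := fun k =>
    ((Measurable.of_discrete (f := fun n : ℕ∞ => (n : ℝ≥0∞))).comp_aemeasurable
      (h.law_count _ (measurableSet_annulus _ _) (by simp [hvol])).aemeasurable).const_mul _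
  have hsum : Summable fun k : ℕ => ((k : ℝ) + 1) ^ (-b) := by
    simpa using (summable_nat_add_iff 1).2 (Real.summable_nat_rpow.2 (by linarith : -b < -1))
  have hint : ∫⁻ ω, ∑' k : ℕ, ENNReal.ofReal (((k : ℝ) + 1) ^ (-b)) *
      ((Pts ω ∩ annulus ((k : ℝ) + 1) (k + 2)).encard : ℝ≥0∞) ∂P ≠ ⊤ := by
    rw [lintegral_tsum hmeas]
    have : ∀ k : ℕ, ∫⁻ ω, ENNReal.ofReal (((k : ℝ) + 1) ^ (-b)) *
        ((Pts ω ∩ annulus ((k : ℝ) + 1) (k + 2)).encard : ℝ≥0∞) ∂P =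
        ENNReal.ofReal (((k : ℝ) + 1) ^ (-b)) * (ENNReal.ofReal lam * ENNReal.ofReal Real.pi) :=
      fun k => by
        rw [lintegral_const_mul' _ _ ENNReal.ofReal_ne_top,
          h.lintegral_encard (measurableSet_annulus _ _) (by simp [hvol]), hvol]
    simp_rw [this]
    rw [ENNReal.tsum_mul_right]
    refine ENNReal.mul_ne_top ?_ (by finiteness)
    rw [← ENNReal.ofReal_tsum_of_nonneg (fun k => by positivity) hsum]
    exact ENNReal.ofReal_ne_top
  filter_upwards [ae_lt_top' (AEMeasurable.tsum hmeas) hint,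
    h.ae_finite (B := Metric.closedBall 0 1) measurableSet_closedBall measure_closedBall_lt_top]
    with ω hω hfin
  set g : Plane → ℝ := fun e => pathGain b ‖e‖ with hg
  have hfar : Summable fun e : Pts ω => (Metric.closedBall (0 : Plane) 1)ᶜ.indicator g e := by
    have hle : ∀ e : Pts ω,
        ENNReal.ofReal ((Metric.closedBall (0 : Plane) 1)ᶜ.indicator g e) ≤
        ∑' k : ℕ, ENNReal.ofReal (((k : ℝ) + 1) ^ (-b)) *
          (annulus ((k : ℝ) + 1) (k + 2)).indicator (fun _ => (1 : ℝ≥0∞)) (e : Plane) := by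
      intro e
      by_cases he : (e : Plane) ∈ (Metric.closedBall (0 : Plane) 1)ᶜ
      · rw [indicator_of_mem he]
        have h1 : 1 < ‖(e : Plane)‖ := by simpa using he
        have ht : 1 < ‖(e : Plane)‖ ^ 2 := by nlinarith
        have hceil : 1 < ⌈‖(e : Plane)‖ ^ 2⌉₊ := Nat.lt_ceil.2 (by simpa using ht)
        -- The ceiling of the squared norm is `k + 2`, which places the point in the annulus `(k +
        -- 1, k + 2]`.
        obtain ⟨k, hk⟩ := Nat.exists_eq_add_of_le' hceil
        rw [Nat.succ_eq_add_one, one_add_one_eq_two] at hk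
        rw [Nat.ceil_eq_iff (by omega)] at hk
        have hk1 : (k : ℝ) + 1 < ‖(e : Plane)‖ ^ 2 := by simpa using hk.1
        have hk2 : ‖(e : Plane)‖ ^ 2 ≤ (k : ℝ) + 2 := by simpa using hk.2
        refine le_trans ?_ (ENNReal.le_tsum k)
        rw [indicator_of_mem (show (e : Plane) ∈ annulus ((k : ℝ) + 1) (k + 2) from ⟨hk1, hk2⟩),
          mul_one, hg]
        refine ENNReal.ofReal_le_ofReal ?_
        dsimp only
        rw [pathGain_eq b (norm_nonneg _)]
        exact Real.rpow_le_rpow_of_nonpos (by positivity) hk1.le (by linarith)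
      · rw [indicator_of_notMem he]; simp
    have hne : ∑' e : Pts ω, ENNReal.ofReal ((Metric.closedBall (0 : Plane) 1)ᶜ.indicator g e) ≠ ⊤ := by
      refine ne_of_lt ((ENNReal.tsum_le_tsum hle).trans_lt ?_)
      rw [ENNReal.tsum_comm]
      simpa only [ENNReal.tsum_mul_left, tsum_indicator_one_eq_encard] using hω
    refine (ENNReal.summable_toReal hne).congr fun e => ?_
    rw [ENNReal.toReal_ofReal]
    exact indicator_nonneg (fun x _ => pathGain_nonneg b (norm_nonneg x)) _
  have hnear : Summable fun e : Pts ω => (Metric.closedBall (0 : Plane) 1).indicator g e := by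
    refine summable_of_hasFiniteSupport ?_
    refine Set.Finite.subset (hfin.preimage (f := ((↑) : Pts ω → Plane))
      Subtype.val_injective.injOn) ?_
    intro e he
    refine ⟨e.2, ?_⟩
    by_contra hne
    exact he (indicator_of_notMem hne _)
  refine (hnear.add hfar).congr fun e => ?_
  exact congrFun (indicator_self_add_compl (Metric.closedBall (0 : Plane) 1) g) e

lemma ae_ne_zero (h : IsPoissonProcess P lam Pts) : ∀ᵐ ω ∂P, ∀ e ∈ Pts ω, e ≠ 0 := by
  filter_upwards [h.ae_inter_eq_empty (measurableSet_singleton (0 : Plane)) (by simp)] with ω hω e he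
  rintro rfl
  have : (0 : Plane) ∈ Pts ω ∩ {0} := ⟨he, rfl⟩
  simp [hω] at this

lemma ae_tsum_stepSum (h : IsPoissonProcess P lam Pts) (F : ℝ → ℝ) (n : ℕ) :
    ∀ᵐ ω ∂P, ∑' e : Pts ω, stepSum F n (‖(e : Plane)‖ ^ 2) =
      ∑ k : Fin (n ^ 2), F (((k : ℝ) + 1) / n) *
        ((Pts ω ∩ annulus ((k : ℝ) / n) (((k : ℝ) + 1) / n)).encard.toNat : ℝ) := by
  -- Finiteness matters because `toNat` sends an infinite count to `0`.
  have hfin : ∀ᵐ ω ∂P, ∀ k : Fin (n ^ 2),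
      (Pts ω ∩ annulus ((k : ℝ) / n) (((k : ℝ) + 1) / n)).Finite :=
    ae_all_iff.2 fun k => h.ae_finite (measurableSet_annulus _ _) (by
      rw [volume_annulus (by positivity) (by gcongr; linarith)]; exact ENNReal.ofReal_lt_top)
  filter_upwards [hfin] with ω hω
  refine HasSum.tsum_eq ?_
  unfold stepSum
  refine hasSum_sum fun k _ => ?_
  refine ((hasSum_indicator_one_toNat_encard (hω k)).mul_left (F (((k : ℝ) + 1) / n))).congr_fun
    fun e => ?_
  by_cases he : (e : Plane) ∈ annulus ((k : ℝ) / n) (((k : ℝ) + 1) / n)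
  · rw [indicator_of_mem he, indicator_of_mem (mem_annulus.1 he), mul_one]
  · rw [indicator_of_notMem he, indicator_of_notMem (mt mem_annulus.2 he), mul_zero]

/-- Dominated convergence for series, almost surely: `t ^ (-b)` is decreasing, so it is its own
envelope, and the dominating series is the convergent sum of gains. Points at the origin, where step
functions do not approximate, are almost surely absent. -/
lemma ae_tendsto_sum_encard (h : IsPoissonProcess P lam Pts) {b : ℝ} (hb : 1 < b) :
    ∀ᵐ ω ∂P, Tendsto (fun n : ℕ => ∑ k : Fin (n ^ 2), (((k : ℝ) + 1) / n) ^ (-b) *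
        ((Pts ω ∩ annulus ((k : ℝ) / n) (((k : ℝ) + 1) / n)).encard.toNat : ℝ)) atTop
      (𝓝 (∑' e : Pts ω, pathGain b ‖(e : Plane)‖)) := by
  filter_upwards [ae_all_iff.2 (h.ae_tsum_stepSum fun t => t ^ (-b)), h.ae_ne_zero,
    h.ae_summable_pathGain hb] with ω hω h0 hs
  simp_rw [← hω]
  have hpos : ∀ e : Pts ω, 0 < ‖(e : Plane)‖ ^ 2 := fun e => by
    have := norm_pos_iff.2 (h0 e e.2)
    positivity
  refine tendsto_tsum_of_dominated_convergence hs (fun e => ?_) (Eventually.of_forall fun n e => ?_)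
  · rw [pathGain_eq b (norm_nonneg _)]
    exact tendsto_stepSum (F := fun t : ℝ => t ^ (-b)) (hpos e)
      (Real.continuousAt_rpow_const _ (-b) (Or.inl (hpos e).ne'))
  · rw [pathGain_eq b (norm_nonneg _)]
    refine norm_stepSum_le (F := fun t : ℝ => t ^ (-b)) (G := fun t : ℝ => t ^ (-b))
      (fun s hs => ?_) (fun s hs t ht hst => ?_) n (hpos e)
    · rw [Real.norm_of_nonneg (by positivity)]
    · exact Real.rpow_le_rpow_of_nonpos hs hst (by linarith)

lemma aemeasurable_sum_encard (h : IsPoissonProcess P lam Pts) (c : ℕ → ℝ) (n : ℕ) :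
    AEMeasurable (fun ω => ∑ k : Fin (n ^ 2), c k *
        ((Pts ω ∩ annulus ((k : ℝ) / n) (((k : ℝ) + 1) / n)).encard.toNat : ℝ)) P := by
  refine Finset.aemeasurable_fun_sum _ fun k _ => AEMeasurable.const_mul ?_ _
  refine (Measurable.of_discrete (f := fun n : ℕ∞ => (n.toNat : ℝ))).comp_aemeasurable
    (h.law_count _ (measurableSet_annulus _ _) ?_).aemeasurable
  rw [volume_annulus (by positivity) (by gcongr; linarith)]; exact ENNReal.ofReal_lt_top

lemma aemeasurable_tsum_pathGain (h : IsPoissonProcess P lam Pts) {b : ℝ} (hb : 1 < b) :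
    AEMeasurable (fun ω => ∑' e : Pts ω, pathGain b ‖(e : Plane)‖) P :=
  aemeasurable_of_tendsto_metrizable_ae atTop
    (fun n : ℕ => h.aemeasurable_sum_encard (fun k => (((k : ℝ) + 1) / n) ^ (-b)) n)
    (h.ae_tendsto_sum_encard hb)

/-- Campbell's formula by uniqueness of limits: the characteristic functions of the step sums
converge to that of the full sum, and are also exponentials of Riemann sums of the exponent, each
annulus having area `π / n`. -/
lemma charFun_tsum_pathGain [IsProbabilityMeasure P] (h : IsPoissonProcess P lam Pts)
    (hlam : 0 ≤ lam) {b : ℝ} (hb : 1 < b) (w : ℝ) :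
    charFun (P.map fun ω => ∑' e : Pts ω, pathGain b ‖(e : Plane)‖) w =
      stableCharFun (1 / b) 1 (Real.pi * lam * (stableConst (1 / b))⁻¹) w := by
  have hmeas : ∀ n : ℕ, AEMeasurable (fun ω => ∑ k : Fin (n ^ 2), (((k : ℝ) + 1) / n) ^ (-b) *
      ((Pts ω ∩ annulus ((k : ℝ) / n) (((k : ℝ) + 1) / n)).encard.toNat : ℝ)) P := fun n =>
    h.aemeasurable_sum_encard (fun k => (((k : ℝ) + 1) / n) ^ (-b)) n
  have h1 : Tendsto (fun n : ℕ => charFun (P.map fun ω => ∑ k : Fin (n ^ 2),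
      (((k : ℝ) + 1) / n) ^ (-b) *
        ((Pts ω ∩ annulus ((k : ℝ) / n) (((k : ℝ) + 1) / n)).encard.toNat : ℝ)) w) atTop
      (𝓝 (charFun (P.map fun ω => ∑' e : Pts ω, pathGain b ‖(e : Plane)‖) w)) := by
    have hc : Continuous fun x : ℝ => Complex.exp (w * x * Complex.I) := by fun_prop
    simp_rw [charFun_apply_real]
    rw [integral_map (h.aemeasurable_tsum_pathGain hb) hc.aestronglyMeasurable]
    simp_rw [fun n => integral_map (hmeas n) hc.aestronglyMeasurable]
    refine tendsto_integral_of_dominated_convergence (fun _ => 1)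
      (fun n => (hc.measurable.comp_aemeasurable (hmeas n)).aestronglyMeasurable)
      (integrable_const _) (fun n => ae_of_all _ fun ω => ?_) ?_
    · rw [← Complex.ofReal_mul, Complex.norm_exp_ofReal_mul_I]
    · filter_upwards [h.ae_tendsto_sum_encard hb] with ω hω
      exact (hc.tendsto _).comp hω
  have h2 : ∀ n : ℕ, charFun (P.map fun ω => ∑ k : Fin (n ^ 2), (((k : ℝ) + 1) / n) ^ (-b) *
        ((Pts ω ∩ annulus ((k : ℝ) / n) (((k : ℝ) + 1) / n)).encard.toNat : ℝ)) w =
      Complex.exp ((lam * Real.pi : ℝ) * ∑ k : Fin (n ^ 2), ((1 / n : ℝ) : ℂ) *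
        (Complex.exp (((w * (((k : ℝ) + 1) / n) ^ (-b) : ℝ) : ℂ) * Complex.I) - 1)) := by
    intro n
    have hvol : ∀ k : Fin (n ^ 2), volume (annulus ((k : ℝ) / n) (((k : ℝ) + 1) / n)) =
        ENNReal.ofReal (Real.pi * (1 / n)) := fun k => by
      rw [volume_annulus (by positivity) (by gcongr; linarith)]; congr 1; ring
    rw [h.charFun_sum_mul_encard hlam (B := fun k : Fin (n ^ 2) =>
      annulus ((k : ℝ) / n) (((k : ℝ) + 1) / n)) (fun k => measurableSet_annulus _ _)
      (fun k => by rw [hvol]; exact ENNReal.ofReal_lt_top)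
      (fun i j hij => disjoint_annulus (disjoint_left.2 fun t hi hj => ?_))
      (fun k => (((k : ℝ) + 1) / n) ^ (-b)), Finset.mul_sum]
    · congr 1
      refine Finset.sum_congr rfl fun k _ => ?_
      rw [measureReal_def, hvol, ENNReal.toReal_ofReal (by positivity)]
      push_cast
      ring
    -- For `n = 0` the index type is empty, so the index `i` excludes this case.
    · have hn : 0 < n := by
        rcases Nat.eq_zero_or_pos n with rfl | hn
        · exact absurd i.2 (by simp)
        · exact hn
      rw [mem_Ioc_div_iff hn] at hi hj
      exact hij (Fin.ext (by omega))
  simp_rw [h2] at h1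
  have h3 := (Complex.continuous_exp.tendsto _).comp
    ((tendsto_sum_cexp_sub_one hb w).const_mul ((lam * Real.pi : ℝ) : ℂ))
  rw [tendsto_nhds_unique h1 h3, integral_one_sub_cexp_rpow_neg hb w, stableCharFun,
    if_neg (by rw [div_eq_one_iff_eq (by linarith)]; exact hb.ne)]
  congr 1
  push_cast
  ring

end IsPoissonProcess

/-! ### Stable laws: absence of atoms and uniqueness -/

/-- After translating `x` to `0`, the mean of the characteristic function over `[-r, r]` equals `∫
sinc (r y) dν`, which tends to the mass at `0`. Integrability makes the same mean `O(1 / r)`. -/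
lemma measureReal_singleton_eq_zero_of_integrable_charFun {μ : Measure ℝ} [IsProbabilityMeasure μ]
    (h : Integrable (charFun μ)) (x : ℝ) : μ.real {x} = 0 := by
  set ν := μ.map (· + -x) with hν
  have : IsProbabilityMeasure ν := Measure.isProbabilityMeasure_map (by fun_prop)
  have hνc : ∀ t, ‖charFun ν t‖ = ‖charFun μ t‖ := fun t => by
    rw [hν, charFun_map_add_const, norm_mul]
    have := Complex.norm_exp_ofReal_mul_I (inner ℝ (-x) t)
    simp_all
  have hν0 : ν.real {0} = μ.real {x} := by
    rw [hν, map_measureReal_apply (by fun_prop) (measurableSet_singleton _)]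
    congr 1; ext y; simp [← sub_eq_add_neg, sub_eq_zero]
  rw [← hν0]
  have h1 : Tendsto (fun r : ℝ => ∫ y, Real.sinc (r * y) ∂ν) atTop
      (𝓝 (∫ y, ({0} : Set ℝ).indicator (fun _ => (1 : ℝ)) y ∂ν)) := by
    refine tendsto_integral_filter_of_dominated_convergence (fun _ => 1)
      (Eventually.of_forall fun r => by fun_prop)
      (Eventually.of_forall fun r => ae_of_all _ fun y => Real.abs_sinc_le_one _)
      (integrable_const _) (ae_of_all _ fun y => ?_)
    rcases eq_or_ne y 0 with rfl | hy
    · simp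
    · rw [indicator_of_notMem (by simpa using hy)]
      have hlim : Tendsto (fun r : ℝ => (r * |y|)⁻¹) atTop (𝓝 0) :=
        (tendsto_id.atTop_mul_const (abs_pos.2 hy)).inv_tendsto_atTop
      refine squeeze_zero_norm' ?_ hlim
      filter_upwards [eventually_gt_atTop 0] with r hr
      rw [Real.sinc_of_ne_zero (by positivity), norm_div, Real.norm_eq_abs (r * y), abs_mul,
        abs_of_pos hr, div_eq_mul_inv]
      exact mul_le_of_le_one_left (by positivity) (Real.abs_sin_le_one _)
  have h2 : Tendsto (fun r : ℝ => ∫ y, Real.sinc (r * y) ∂ν) atTop (𝓝 0) := by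
    have hlim : Tendsto (fun r : ℝ => (2 * r)⁻¹ * ∫ t, ‖charFun μ t‖) atTop (𝓝 0) := by
      have : Tendsto (fun r : ℝ => (2 * r)⁻¹) atTop (𝓝 0) :=
        (tendsto_id.const_mul_atTop two_pos).inv_tendsto_atTop
      simpa using this.mul_const (∫ t, ‖charFun μ t‖)
    refine squeeze_zero_norm' ?_ hlim
    filter_upwards [eventually_gt_atTop 0] with r hr
    have key := congrArg norm (integral_charFun_Icc (μ := ν) hr)
    have hle : ‖∫ t in -r..r, charFun ν t‖ ≤ ∫ t, ‖charFun μ t‖ := by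
      refine (intervalIntegral.norm_integral_le_integral_norm (by linarith)).trans ?_
      rw [intervalIntegral.integral_of_le (by linarith)]
      simp_rw [hνc]
      exact setIntegral_le_integral h.norm (ae_of_all _ fun t => norm_nonneg _)
    rw [key, norm_mul, norm_mul] at hle
    rw [inv_mul_eq_div, le_div_iff₀ (by positivity), mul_comm]
    simpa [abs_of_pos hr] using hle
  have := tendsto_nhds_unique h1 h2
  rwa [integral_indicator_const _ (measurableSet_singleton _), smul_eq_mul, mul_one] at this

lemma norm_stableCharFun {α : ℝ} (hα : α ≠ 1) (β γ w : ℝ) :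
    ‖stableCharFun α β γ w‖ = Real.exp (-(γ * |w| ^ α)) := by
  rw [stableCharFun, if_neg hα, Complex.norm_exp, ← Complex.ofReal_neg, Complex.re_ofReal_mul]
  generalize β * Real.sign w * Real.tan (Real.pi * α / 2) = x
  simp

lemma integrable_exp_neg_abs_rpow {α : ℝ} (hα : 0 < α) {γ : ℝ} (hγ : 0 < γ) :
    Integrable fun w : ℝ => Real.exp (-(γ * |w| ^ α)) := by
  have h : IntegrableOn (fun w : ℝ => Real.exp (-(γ * |w| ^ α))) (Ioi 0) := by
    refine (integrableOn_rpow_mul_exp_neg_mul_rpow (s := 0) (by norm_num) hα hγ).congr_fun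
      (fun w hw => ?_) measurableSet_Ioi
    simp [abs_of_pos (mem_Ioi.1 hw)]
  have h' : IntegrableOn (fun w : ℝ => Real.exp (-(γ * |w| ^ α))) (Iic 0) := by
    have m : MeasurableEmbedding fun x : ℝ => -x := (Homeomorph.neg ℝ).measurableEmbedding
    rw [← Measure.map_neg_eq_self (volume : Measure ℝ), m.integrableOn_map_iff]
    simpa [Function.comp_def, integrableOn_Ici_iff_integrableOn_Ioi] using h
  rw [← integrableOn_univ, ← Iic_union_Ioi]
  exact h'.union h

namespace IsStableLaw

variable {α β γ : ℝ} {ν : Measure ℝ}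

lemma measureReal_singleton (h : IsStableLaw α β γ ν) (hα : α ≠ 1) (hγ : 0 < γ) (x : ℝ) :
    ν.real {x} = 0 := by
  have := h.isProbabilityMeasure
  refine measureReal_singleton_eq_zero_of_integrable_charFun ?_ x
  refine (integrable_exp_neg_abs_rpow h.exponent_mem.1 hγ).mono' (by fun_prop) (ae_of_all _ fun w => ?_)
  rw [h.charFun_eq, norm_stableCharFun hα]

lemma eq_of_isStableLaw (h : IsStableLaw α β γ ν) {ν' : Measure ℝ} (h' : IsStableLaw α β γ ν') :
    ν = ν' := by
  have := h.isProbabilityMeasure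
  have := h'.isProbabilityMeasure
  exact Measure.ext_of_charFun (funext fun w => by rw [h.charFun_eq, h'.charFun_eq])

lemma measureReal_Ici (h : IsStableLaw α β γ ν) (hα : α ≠ 1) (hγ : 0 < γ) (x : ℝ) :
    ν.real (Ici x) = 1 - cdf ν x := by
  have := h.isProbabilityMeasure
  rw [cdf_eq_real, ← probReal_compl_eq_one_sub measurableSet_Iic, compl_Iic, ← Ioi_insert,
    insert_eq, measureReal_union (by simp) measurableSet_Ioi, h.measureReal_singleton hα hγ, zero_add]

end IsStableLaw

/-! ### Scaling of the power and the law of the secrecy rate -/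

/-- No summability is needed, a divergent `tsum` being `0`; hence the comparisons of the secrecy
rate below hold for every outcome, not just almost surely. -/
lemma aggregatePower_nonneg {Pl : ℝ} (hPl : 0 ≤ Pl) (b : ℝ) (S : Set Plane) :
    0 ≤ aggregatePower Pl (pathGain b) S :=
  mul_nonneg hPl (tsum_nonneg fun _ => pathGain_nonneg b (norm_nonneg _))

lemma stableConst_pos {α : ℝ} (hα0 : 0 ≤ α) (hα : α < 1) : 0 < stableConst α := by
  refine div_pos (by linarith) (mul_pos (Real.Gamma_pos_of_pos (by linarith)) ?_)
  exact Real.cos_pos_of_mem_Ioo ⟨by nlinarith [Real.pi_pos], by nlinarith [Real.pi_pos]⟩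

lemma stableCharFun_mul {α : ℝ} (hα : α ≠ 1) {c : ℝ} (hc : 0 < c) (β γ w : ℝ) :
    stableCharFun α β γ (c * w) = stableCharFun α β (γ * c ^ α) w := by
  have hs : Real.sign (c * w) = Real.sign w := by
    rcases lt_trichotomy w 0 with h | rfl | h
    · rw [Real.sign_of_neg h, Real.sign_of_neg (mul_neg_of_pos_of_neg hc h)]
    · rw [mul_zero]
    · rw [Real.sign_of_pos h, Real.sign_of_pos (mul_pos hc h)]
  rw [stableCharFun, stableCharFun, if_neg hα, if_neg hα, abs_mul, abs_of_pos hc,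
    Real.mul_rpow hc.le (abs_nonneg w), hs, mul_assoc γ]

lemma IsPoissonProcess.isStableLaw_map_mul {Ω : Type*} [MeasurableSpace Ω] {P : Measure Ω}
    [IsProbabilityMeasure P] {lam : ℝ} {Pts : Ω → Set Plane} (h : IsPoissonProcess P lam Pts)
    (hlam : 0 < lam) {b : ℝ} (hb : 1 < b) {c : ℝ} (hc : 0 < c) :
    IsStableLaw (1 / b) 1 (Real.pi * lam * (stableConst (1 / b))⁻¹ * c ^ (1 / b))
      (P.map fun ω => c * ∑' e : Pts ω, pathGain b ‖(e : Plane)‖) := by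
  have hb0 : 0 < b := by linarith
  have hb1 : 1 / b < 1 := by rwa [div_lt_one hb0]
  have hC := stableConst_pos (by positivity) hb1
  refine ⟨⟨by positivity, by linarith⟩, by simp, by positivity,
    Measure.isProbabilityMeasure_map ((h.aemeasurable_tsum_pathGain hb).const_mul c), fun w => ?_⟩
  rw [charFun_map_mul_comp (h.aemeasurable_tsum_pathGain hb), h.charFun_tsum_pathGain hlam.le hb,
    stableCharFun_mul hb1.ne hc]

lemma maxSecrecyRate_le_iff {Pl σl σe rl b ϱ : ℝ} (hPl : 0 ≤ Pl) (hσe : 0 < σe) (hrl : 0 < rl)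
    (hϱ : 0 ≤ ϱ) (S : Set Plane) :
    maxSecrecyRate Pl σl σe (pathGain b) rl S ≤ ϱ ↔
      ((1 + Pl / (rl ^ (2 * b) * σl ^ 2)) * (2 : ℝ) ^ (-ϱ) - 1) * σe ^ 2 ≤
        aggregatePower Pl (pathGain b) S := by
  have hA := aggregatePower_nonneg hPl b S
  set A := aggregatePower Pl (pathGain b) S with hAdef
  have hK : 0 ≤ Pl / (rl ^ (2 * b) * σl ^ 2) := by positivity
  rw [maxSecrecyRate, ← hAdef, max_le_iff, and_iff_left hϱ, gaussianCapacity, gaussianCapacity,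
    pathGain, mul_one_div, div_div]
  set K := Pl / (rl ^ (2 * b) * σl ^ 2)
  have hA' : 0 < 1 + A / σe ^ 2 := by positivity
  rw [← Real.logb_div (by positivity) hA'.ne', Real.logb_le_iff_le_rpow one_lt_two (by positivity),
    div_le_iff₀ hA', Real.rpow_neg zero_le_two, ← div_eq_mul_inv, ← le_div_iff₀ (by positivity),
    sub_le_iff_le_add, div_le_iff₀ (by positivity), add_comm (A / σe ^ 2), mul_comm]

lemma maxSecrecyRate_le {Pl σe b : ℝ} (hPl : 0 ≤ Pl) (σl rl : ℝ) (hσe : 0 < σe) (S : Set Plane) :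
    maxSecrecyRate Pl σl σe (pathGain b) rl S ≤
      max (Real.logb 2 (1 + Pl / (rl ^ (2 * b) * σl ^ 2))) 0 := by
  have hA := aggregatePower_nonneg hPl b S
  rw [maxSecrecyRate, gaussianCapacity, gaussianCapacity, pathGain, mul_one_div, div_div]
  refine max_le_max (sub_le_self _ (Real.logb_nonneg one_lt_two ?_)) le_rfl
  have : 0 ≤ aggregatePower Pl (pathGain b) S / σe ^ 2 := by positivity
  linarith

theorem mainTheorem11 {Ω : Type*} [MeasurableSpace Ω] (P : Measure Ω) [IsProbabilityMeasure P]
    (lam b Pl σl σe rl : ℝ) (hlam : 0 < lam) (hb : 1 < b) (hPl : 0 < Pl)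
    (hσl : 0 < σl) (hσe : 0 < σe) (hrl : 0 < rl)
    (Pts : Ω → Set Plane) (hPts : IsPoissonProcess P lam Pts) :
    -- the aggregate power is almost surely a convergent sum of positive terms
    (∀ᵐ ω ∂P, (∀ e ∈ Pts ω, e ≠ 0) ∧
      Summable (fun e : Pts ω => pathGain b ‖(e : Plane)‖)) ∧
    -- it is a skewed stable random variable
    (AEMeasurable (fun ω => aggregatePower Pl (pathGain b) (Pts ω)) P ∧
      IsStableLaw (1 / b) 1 (Real.pi * lam * (stableConst (1 / b))⁻¹ * Pl ^ (1 / b))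
        (P.map (fun ω => aggregatePower Pl (pathGain b) (Pts ω)))) ∧
    -- its normalization has the distribution `S(1/b, 1, 1)`
    IsStableLaw (1 / b) 1 1
      (P.map (fun ω => aggregatePower Pl (pathGain b) (Pts ω) *
        (Real.pi * lam * (stableConst (1 / b))⁻¹ * Pl ^ (1 / b)) ^ (-b))) ∧
    -- the maximum secrecy rate is a random variable with the stated distribution function
    AEMeasurable (fun ω => maxSecrecyRate Pl σl σe (pathGain b) rl (Pts ω)) P ∧
    (∀ ν : Measure ℝ, IsStableLaw (1 / b) 1 1 ν → ∀ ϱ : ℝ,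
      cdf (P.map (fun ω => maxSecrecyRate Pl σl σe (pathGain b) rl (Pts ω))) ϱ =
        if ϱ < 0 then 0
        else if ϱ < Real.logb 2 (1 + Pl / (rl ^ (2 * b) * σl ^ 2)) then
          1 - cdf ν
            (((1 + Pl / (rl ^ (2 * b) * σl ^ 2)) * (2 : ℝ) ^ (-ϱ) - 1) /
              ((Real.pi * lam * (stableConst (1 / b))⁻¹) ^ b * (Pl / σe ^ 2)))
        else 1) := by
  have hb0 : 0 < b := by linarith
  have hb1 : 1 / b < 1 := by rwa [div_lt_one hb0]
  have hC := stableConst_pos (by positivity) hb1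
  set κ := Real.pi * lam * (stableConst (1 / b))⁻¹ with hκdef
  have hκ : 0 < κ := by positivity
  set γ := κ * Pl ^ (1 / b) with hγdef
  have hγ : 0 < γ := by positivity
  have hA : AEMeasurable (fun ω => aggregatePower Pl (pathGain b) (Pts ω)) P :=
    (hPts.aemeasurable_tsum_pathGain hb).const_mul Pl
  have hR : AEMeasurable (fun ω => maxSecrecyRate Pl σl σe (pathGain b) rl (Pts ω)) P := by
    have : Measurable fun x : ℝ => max (gaussianCapacity (Pl * pathGain b rl) (σl ^ 2)
        - Real.logb 2 (1 + x / σe ^ 2)) 0 := by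
      simp only [Real.logb]
      fun_prop
    exact this.comp_aemeasurable hA
  have hnorm : IsStableLaw (1 / b) 1 1
      (P.map fun ω => aggregatePower Pl (pathGain b) (Pts ω) * γ ^ (-b)) := by
    have h := hPts.isStableLaw_map_mul hlam hb (c := Pl * γ ^ (-b)) (by positivity)
    -- Scaling by `c` multiplies the dispersion by `c ^ (1 / b)`; here the result is `γ * γ⁻¹`.
    have hc : Real.pi * lam * (stableConst (1 / b))⁻¹ * (Pl * γ ^ (-b)) ^ (1 / b) = 1 := by
      rw [← hκdef, Real.mul_rpow hPl.le (by positivity), ← mul_assoc, ← hγdef,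
        ← Real.rpow_mul hγ.le, show -b * (1 / b) = -1 by field_simp, Real.rpow_neg_one,
        mul_inv_cancel₀ hγ.ne']
    rw [hc] at h
    convert h using 3
    rw [aggregatePower]
    ring
  refine ⟨hPts.ae_ne_zero.and (hPts.ae_summable_pathGain hb),
    ⟨hA, hPts.isStableLaw_map_mul hlam hb hPl⟩, hnorm, hR, fun ν hν ϱ => ?_⟩
  have := Measure.isProbabilityMeasure_map (μ := P) hR
  rw [cdf_eq_real, map_measureReal_apply_of_aemeasurable hR measurableSet_Iic]
  split_ifs with h0 h1
  · have : (fun ω => maxSecrecyRate Pl σl σe (pathGain b) rl (Pts ω)) ⁻¹' Iic ϱ = ∅ :=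
      eq_empty_of_forall_notMem fun ω hω => (h0.trans_le (le_max_right _ _)).not_ge hω
    rw [this, measureReal_empty]
  · rw [not_lt] at h0
    -- Absence of atoms turns `1 - cdf` into the mass of a closed half-line, and uniqueness replaces
    -- `ν` by the law of the normalized power, so it remains to compare two events.
    rw [← hν.measureReal_Ici hb1.ne one_pos, hν.eq_of_isStableLaw hnorm,
      map_measureReal_apply_of_aemeasurable (hA.mul_const _) measurableSet_Ici]
    congr 1
    ext ω
    rw [mem_preimage, mem_Iic, maxSecrecyRate_le_iff hPl.le hσe hrl h0, mem_preimage, mem_Ici,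
      Real.rpow_neg hγ.le, ← div_eq_mul_inv, le_div_iff₀ (by positivity)]
    have hγb : γ ^ b = κ ^ b * Pl := by
      rw [hγdef, Real.mul_rpow hκ.le (by positivity), ← Real.rpow_mul hPl.le,
        one_div_mul_cancel hb0.ne', Real.rpow_one]
    rw [hγb]
    refine Eq.to_iff (congrArg (· ≤ _) ?_)
    have := Real.rpow_pos_of_pos hκ b
    field_simp
  · rw [not_lt] at h1
    have : (fun ω => maxSecrecyRate Pl σl σe (pathGain b) rl (Pts ω)) ⁻¹' Iic ϱ = univ :=
      eq_univ_of_forall fun ω => (maxSecrecyRate_le hPl.le σl rl hσe (Pts ω)).trans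
        (max_le h1 (not_lt.1 h0))
    rw [this, probReal_univ]
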